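/- Let $R$ be a reduced irreducible (crystallographic) root system in a finite-dimensional vector space over $\mathbb{Q}$, with a fixed basis $\alpha_1,\dots,\alpha_r$ of simple roots, positive roots $R^+$, root lattice $Q$ and weight lattice $P$. For $\alpha=\sum k_i\alpha_i$ put $\operatorname{ht}\alpha=\sum k_i$. Let $m(n)$ be the number of positive roots of height $n$, and let the exponents $d_1\le\dots\le d_r$ be the parts of the partition dual to $(m(1)\ge m(2)\ge\cdots)$, i.e. $d_i=\#\{n\ge1 : m(n)\ge r+1-i\}$. Let $q,t$ be independent variables, let $m\ge1$ be an integer with $mP\subset Q$, and let $\mathbb{Q}_{q,t}[P]$ be the group algebra of $P$, spanned by formal exponentials $e^\lambda$ ($\lambda\in P$), over the field $\mathbb{Q}_{q,t}=\mathbb{Q}(q^{1/m},t)$. Let $g\mapsto\bar g^{\iota}$ be the ring endomorphism of $\mathbb{Q}_{q,t}[P]$ with $e^\lambda\mapsto e^{-\lambda}$, $q^{1/m}\mapsto q^{-1/m}$, $t\mapsto t^{-1}$. Cherednik's scalar product is $(f,g)_{q,t}=[f\,\bar g^{\iota}\,C_{q,t}]_0$, where $[\ ]_0$ is the coefficient of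 $e^0$ and $$C_{q,t}=\prod_{\alpha\in R}\prod_{i\ge0}\frac{q^{-(i+\chi(\alpha))/2}e^{\alpha/2}-q^{(i+\chi(\alpha))/2}e^{-\alpha/2}}{t\,q^{-(i+\chi(\alpha))/2}e^{\alpha/2}-t^{-1}q^{(i+\chi(\alpha))/2}e^{-\alpha/2}},\qquad \chi(\alpha)=\begin{cases}0,&\alpha\in R^+,\\1,&-\alpha\in R^+.\end{cases}$$ Here $C_{q,t}$ is taken up to a scalar factor (which does not affect the identity below): each factor is $t^{-1}\cdot\frac{1-q^{x}e^{-\alpha}}{1-t^{-2}q^{x}e^{-\alpha}}$ with $x=i+\chi(\alpha)$, the scalars $t^{-1}$ are dropped, and $$C_{q,t}=\prod_{\alpha\in R}\prod_{i\ge0}\frac{1-q^{i+\chi(\alpha)}e^{-\alpha}}{1-t^{-2}q^{i+\chi(\alpha)}e^{-\alpha}}$$ is expanded as a formal series in the monomials $q^{i+\chi(\alpha)}e^{-\alpha}$. Then the coefficient of each $e^\mu$ in $C_{q,t}$ is a power series in $q$ over $\mathbb{Q}(t)$, so that $(f,g)_{q,t}\in\mathbb{Q}(t)((q^{1/m}))\supset\mathbb{Q}_{q,t}$.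 Then $R$ has a highest root $\theta$ (a root such that $\theta-\beta$ is a sum of simple roots, possibly empty and with repetitions, for every $\beta\in R$), $d_r=\operatorname{ht}\theta$, and for every positive root $\alpha$ $$(e^{\alpha},1)_{q,t}=t^{-2\operatorname{ht}\alpha}\,\frac{t^2-1}{q\,t^{-2d_r}-1}\,(1,1)_{q,t}.$$ -/

import Mathlib

noncomputable section

namespace CherednikProduct

/-! ### Coefficient fields -/

/-- The field `ℚ(t)`. -/
abbrev Qt : Type := RatFunc ℚ

/-- The field `ℚ(q^{1/m}, t)`, as `ℚ(t)(v)` with `v = q^{1/m}`. -/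
abbrev Qqt : Type := RatFunc Qt

/-- The field `ℚ(t)((q^{1/m}))` of formal Laurent series, which contains `ℚ(q^{1/m}, t)`. -/
abbrev SeriesField : Type := LaurentSeries Qt

/-- The variable `t` of `ℚ(t)`. -/
def t₀ : Qt := RatFunc.X

/-- The variable `t` of `ℚ(q^{1/m}, t)`. -/
def t : Qqt := RatFunc.C t₀

/-- The element `q = v ^ m` of `ℚ(q^{1/m}, t)`, where `v = q^{1/m}`. -/
def q (m : ℕ) : Qqt := RatFunc.X ^ m

/-- The embedding of `ℚ(q^{1/m}, t)` in `ℚ(t)((q^{1/m}))`: expansion at `q^{1/m} = 0`. -/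
def embed : Qqt →+* SeriesField :=
  IsFractionRing.lift (FaithfulSMul.algebraMap_injective (Polynomial Qt) SeriesField)

theorem eval₂_X_inv_injective {F : Type*} [Field F] (σ : F →+* F) :
    Function.Injective
      (Polynomial.eval₂RingHom ((RatFunc.C : F →+* RatFunc F).comp σ) (RatFunc.X)⁻¹) := by
  have htr : Transcendental F ((RatFunc.X : RatFunc F)⁻¹) := by
    rw [Transcendental, IsAlgebraic.inv_iff, ← Transcendental, transcendental_iff_injective]
    intro a b hab
    have key : ∀ p : Polynomial F, Polynomial.aeval (RatFunc.X : RatFunc F) p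
        = algebraMap (Polynomial F) (RatFunc F) p := by
      intro p
      rw [← RatFunc.algebraMap_X, Polynomial.aeval_algebraMap_apply, Polynomial.aeval_X_left_apply]
    rw [key, key] at hab
    exact RatFunc.algebraMap_injective F hab
  rw [transcendental_iff_injective] at htr
  have heq : ∀ p : Polynomial F,
      Polynomial.eval₂RingHom ((RatFunc.C : F →+* RatFunc F).comp σ) (RatFunc.X)⁻¹ p
        = Polynomial.aeval ((RatFunc.X : RatFunc F)⁻¹) (p.map σ) := by
    intro p
    rw [Polynomial.aeval_def, Polynomial.eval₂_map]
    rfl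
  intro a b hab
  rw [heq, heq] at hab
  exact Polynomial.map_injective σ σ.injective (htr hab)

/-- The endomorphism of `F(X)` that sends `X` to `X⁻¹` and acts by `σ` on `F`. -/
def invertVar {F : Type*} [Field F] (σ : F →+* F) : RatFunc F →+* RatFunc F :=
  RatFunc.liftRingHom
    (Polynomial.eval₂RingHom ((RatFunc.C : F →+* RatFunc F).comp σ) (RatFunc.X)⁻¹)
    (nonZeroDivisors_le_comap_nonZeroDivisors_of_injective _ (eval₂_X_inv_injective σ))

/-- The involution `q ↦ q⁻¹`, `t ↦ t⁻¹` of `ℚ(q^{1/m}, t)`. -/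
def iota : Qqt →+* Qqt := invertVar (invertVar (RingHom.id ℚ))

section RootSystem

variable {ι E E' : Type*} [AddCommGroup E] [Module ℚ E] [AddCommGroup E'] [Module ℚ E']

/-! ### Weights and exponents -/

/-- The weight lattice: vectors whose pairing with every coroot is an integer. -/
def weightLattice (R : RootPairing ι ℚ E E') : AddSubgroup E where
  carrier := {x | ∀ i, ∃ n : ℤ, R.toLinearMap x (R.coroot i) = n}
  zero_mem' := fun i => ⟨0, by simp⟩
  add_mem' := by
    intro x y hx hy i
    obtain ⟨a, ha⟩ := hx i
    obtain ⟨c, hc⟩ := hy i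
    exact ⟨a + c, by simp [ha, hc]⟩
  neg_mem' := by
    intro x hx i
    obtain ⟨a, ha⟩ := hx i
    exact ⟨-a, by simp [ha]⟩

/-- A root of a crystallographic root system, as a weight. -/
def rootWeight (R : RootPairing ι ℚ E E') [R.IsCrystallographic] (i : ι) : weightLattice R :=
  ⟨R.root i, fun j => by
    obtain ⟨n, hn⟩ := R.exists_value (S := ℤ) i j
    exact ⟨n, by simpa using hn.symm⟩⟩

variable {R : RootPairing ι ℚ E E'}

/-- The root `θ` is the highest root: `θ - β` is a sum of simple roots for every root `β`. -/
def IsHighestRoot (b : R.Base) (θ : ι) : Prop :=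
  ∀ β, R.root θ - R.root β ∈ AddSubmonoid.closure (R.root '' b.support)

/-- The number `m(n)` of positive roots of height `n`. -/
def numRootsOfHeight (b : R.Base) (n : ℕ) : ℕ :=
  {α : ι | b.IsPos α ∧ b.height α = n}.ncard

/-- The rank `r`. -/
def rank (b : R.Base) : ℕ := b.support.card

/-- The exponents `d₁ ≤ … ≤ d_r` : the parts of the partition dual to `m(1) ≥ m(2) ≥ …`,
so that `d_i` is the number of `n ≥ 1` with `m(n) ≥ r + 1 - i` (for `1 ≤ i ≤ r`). -/
def exponent (b : R.Base) (i : ℕ) : ℕ :=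
  {n : ℕ | 1 ≤ n ∧ rank b + 1 - i ≤ numRootsOfHeight b n}.ncard

/-! ### The formal series `C_{q,t}`

The factor of `C_{q,t}` that belongs to a root `α` and an integer `i ≥ 0` is, with `x = i + χ(α)`,

`(q^{-x/2} e^{α/2} - q^{x/2} e^{-α/2}) / (t q^{-x/2} e^{α/2} - t⁻¹ q^{x/2} e^{-α/2})`
`  = t⁻¹ · (1 - q^x e^{-α}) / (1 - t⁻² q^x e^{-α})`.

As usual, `C_{q,t}` is understood up to a scalar factor: the scalars `t⁻¹` (an infinite power of
`t⁻¹` in all) are dropped, and each factor is expanded as a power series in `q^x e^{-α}`. -/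

/-- `χ(α) = 0` for a positive root and `χ(α) = 1` for a negative root. -/
def chi (b : R.Base) (α : ι) : ℕ := by
  classical exact if b.IsPos α then 0 else 1

/-- The coefficient of `z ^ k` in the power series `(1 - z) / (1 - t⁻² z)`. -/
def factorCoeff (k : ℕ) : Qt :=
  PowerSeries.coeff k
    ((1 - PowerSeries.X) * (1 - PowerSeries.C (t₀ ^ (-2 : ℤ)) * PowerSeries.X : PowerSeries Qt)⁻¹)

theorem factorCoeff_zero : factorCoeff 0 = 1 := by
  simp [factorCoeff]

/-- The choices, for every root `α` and every `i ≥ 0`, of an exponent `k (α, i)` (almost all of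
them zero) such that the product of the monomials `(q^{i + χ(α)} e^{-α}) ^ k (α, i)` is
`q^n e^μ`. -/
def expansions (b : R.Base) (μ : E) (n : ℕ) : Set (ι × ℕ →₀ ℕ) :=
  {k | (k.sum fun p j => j • -R.root p.1) = μ ∧
    (k.sum fun p j => j * (p.2 + chi b p.1)) = n}

/-- The coefficient of `q^n e^μ` in
`C_{q,t} = ∏_{α ∈ R} ∏_{i ≥ 0} (1 - q^{i + χ(α)} e^{-α}) / (1 - t⁻² q^{i + χ(α)} e^{-α})`,
obtained by multiplying out the power series of the factors. The sum is finite, see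
`finite_expansions`. -/
def kernelCoeff (b : R.Base) (μ : E) (n : ℕ) : Qt :=
  ∑ᶠ k ∈ expansions b μ n, k.prod fun _ j => factorCoeff j

theorem finite_expansions [Finite ι] [R.IsRootSystem] (b : R.Base) (μ : E) (n : ℕ) :
    (expansions b μ n).Finite := by
  classical
  have := Fintype.ofFinite ι
  -- the height as a linear functional
  let ht : E →ₗ[ℚ] ℚ := b.toWeightBasis.constr ℚ (fun _ => (1 : ℚ))
  have hsimple : ∀ j ∈ b.support, ht (R.root j) = 1 := by
    intro j hj
    have h := b.toWeightBasis.constr_basis ℚ (fun _ => (1 : ℚ)) ⟨j, hj⟩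
    rw [RootPairing.Base.toWeightBasis_apply] at h
    exact h
  have hht : ∀ i, ht (R.root i) = b.height i := by
    intro i
    obtain ⟨f, -, -, hf⟩ := b.exists_root_eq_sum_int i
    rw [RootPairing.Base.height_eq_sum hf, hf, map_sum, Int.cast_sum]
    refine Finset.sum_congr rfl fun j hj => ?_
    rw [map_zsmul, hsimple j hj]
    simp
  let H : ℕ := ∑ i : ι, (b.height i).natAbs
  have hH : ∀ i, -(H : ℤ) ≤ b.height i := by
    intro i
    have h1 : (b.height i).natAbs ≤ H :=
      Finset.single_le_sum (f := fun i => (b.height i).natAbs) (fun _ _ => Nat.zero_le _)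
        (Finset.mem_univ i)
    omega
  let x : ι × ℕ → ℕ := fun p => p.2 + chi b p.1
  -- an integer weight that is positive on all positive affine roots
  let w : ι × ℕ → ℤ := fun p => b.height p.1 + (H + 1) * x p
  have hw1 : ∀ p, 1 ≤ w p := by
    intro p
    by_cases hp : b.IsPos p.1
    · have h1 : 0 < b.height p.1 := hp
      have h2 : (0 : ℤ) ≤ (H + 1) * x p := by positivity
      simp only [w]; omega
    · have hx : (1 : ℤ) ≤ x p := by simp [x, chi, hp]
      have h3 := hH p.1
      simp only [w]; nlinarith
  have hw2 : ∀ p, (p.2 : ℤ) ≤ w p := by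
    intro p
    by_cases hp : b.IsPos p.1
    · have h1 : 0 < b.height p.1 := hp
      have hx : (p.2 : ℤ) ≤ x p := by simp [x]
      simp only [w]; nlinarith
    · have hx : (x p : ℤ) = p.2 + 1 := by simp [x, chi, hp]
      have h3 := hH p.1
      simp only [w]; rw [hx]; nlinarith
  obtain ⟨W, hW⟩ : ∃ W : ℕ, -ht μ + (H + 1) * n ≤ W := exists_nat_ge _
  let T : Finset (ι × ℕ) := Finset.univ ×ˢ Finset.range (W + 1)
  refine (Set.finite_Iic (Finsupp.indicator T (fun _ _ => W))).subset ?_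
  rintro k ⟨hk1, hk2⟩
  have htot : ∑ p ∈ k.support, (k p : ℤ) * w p ≤ W := by
    have e1 : ht μ = -∑ p ∈ k.support, (k p : ℚ) * b.height p.1 := by
      rw [← hk1, Finsupp.sum, map_sum, ← Finset.sum_neg_distrib]
      refine Finset.sum_congr rfl fun p _ => ?_
      rw [map_nsmul, map_neg, hht]
      simp
    have e2 : (n : ℚ) = ∑ p ∈ k.support, (k p : ℚ) * x p := by
      rw [← hk2, Finsupp.sum]
      push_cast
      simp [x]
    have e3 : ((∑ p ∈ k.support, (k p : ℤ) * w p : ℤ) : ℚ) ≤ W := by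
      refine le_trans (le_of_eq ?_) hW
      rw [e1, e2, neg_neg, Finset.mul_sum, ← Finset.sum_add_distrib]
      push_cast
      refine Finset.sum_congr rfl fun p _ => ?_
      simp only [w]
      push_cast
      ring
    exact_mod_cast e3
  have hle : ∀ p ∈ k.support, (k p : ℤ) * w p ≤ W := by
    intro p hp
    refine le_trans ?_ htot
    refine Finset.single_le_sum (f := fun p => (k p : ℤ) * w p) (fun p' _ => ?_) hp
    have := hw1 p'
    positivity
  intro p
  by_cases hp : p ∈ k.support
  · have h1 := hle p hp
    have h2 : (1 : ℤ) ≤ k p := by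
      have : k p ≠ 0 := Finsupp.mem_support_iff.mp hp
      omega
    have h3 := hw1 p
    have h4 := hw2 p
    have h5 : (k p : ℤ) ≤ W := by nlinarith
    have h6 : (p.2 : ℤ) ≤ W := by nlinarith
    have hT : p ∈ T := by
      simp only [T, Finset.mem_product, Finset.mem_univ, Finset.mem_range, true_and]
      omega
    rw [Finsupp.indicator_of_mem hT]
    exact_mod_cast h5
  · rw [Finsupp.notMem_support_iff.mp hp]
    exact Nat.zero_le _

/-- The coefficient of `e^μ` in `C_{q,t}`, a power series in `q` over `ℚ(t)`. -/
def kernel (b : R.Base) (μ : E) : PowerSeries Qt :=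
  PowerSeries.mk fun n => kernelCoeff b μ n

/-! ### Cherednik's scalar product -/

/-- The group algebra of the weight lattice over `ℚ(q^{1/m}, t)`. -/
abbrev Poly (R : RootPairing ι ℚ E E') : Type _ := AddMonoidAlgebra Qqt (weightLattice R)

/-- The formal exponential `e^μ`. -/
def e (μ : weightLattice R) : Poly R := AddMonoidAlgebra.single μ 1

/-- The map `g ↦ ḡ^ι`: it sends `e^μ` to `e^{-μ}` and acts by `iota` on coefficients. -/
def barIota : Poly R →+* Poly R :=
  (AddMonoidAlgebra.mapDomainRingHom Qqt (negAddMonoidHom : weightLattice R →+ weightLattice R)).comp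
    (AddMonoidAlgebra.mapRingHom (weightLattice R) iota)

/-- The constant term `[h · C_{q,t}]_0`, a series in `q^{1/m}`. Here `PowerSeries.expand m`
rewrites a series in `q` as a series in `q^{1/m}`. -/
def constantTerm (m : ℕ) (hm : m ≠ 0) (b : R.Base) (h : Poly R) : SeriesField :=
  h.coeff.sum fun μ a =>
    embed a *
      HahnSeries.ofPowerSeries ℤ Qt (PowerSeries.expand m hm (kernel b (-(μ : E))))

/-- Cherednik's scalar product `(f, g)_{q,t} = [f ḡ^ι C_{q,t}]_0`. -/
def scalarProduct (m : ℕ) (hm : m ≠ 0) (b : R.Base) (f g : Poly R) : SeriesField :=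
  constantTerm m hm b (f * barIota g)

end RootSystem

end CherednikProduct

end

/-! Write τ = t⁻². The exponents (-α, i + χ(α)) of the monomials in C are the positive affine roots.
A simple affine reflection, attached to (-α_i, 0) or to (θ, 1), permutes all of them except its own
root a, which it negates. Hence C · (1 - τ e^a) / (1 - e^a) is invariant under it, which amounts to
a four-term linear relation between coefficients of C (`productCoeff_reflect`).

Taken at the roots and at 0, these relations determine every coefficient [e^β]C from c = [e^0]C: the
homogeneous system has only the zero solution (`IsHighestRoot.eq_zero_of_relations`). An explicit
solution is τ^(-ht β) x for β > 0 and τ^(-ht β) y for β < 0 (`heightSolution`): the simple roots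
force x = τ y + (1 - τ) c, and the affine one forces x = τ^(ht θ + 1) q y. Eliminating x gives (q
τ^(ht θ) - 1) y = (τ⁻¹ - 1) c, and (e^α, 1) is the coefficient at -α, namely τ^(ht α) y.

The highest root comes from dominance: every root lies below a dominant one, and in an irreducible
system a dominant root involves all simple roots, so it has positive product with a root of maximal
height. -/

noncomputable section

namespace CherednikProduct

/-! ### Formal products of factors (1 - z) / (1 - τ z) and reflections of their exponents -/

section Expansion

variable {A M F : Type*} [AddCommGroup M] [Field F]

/-- The coefficient at `x` of the formal product `∏ p, ∑ j, f j • e ^ (j • v p)`. -/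
def productCoeff (v : A → M) (f : ℕ → F) (x : M) : F :=
  ∑ᶠ k ∈ {k : A →₀ ℕ | (k.sum fun p j => j • v p) = x}, k.prod fun _ j => f j

/-- The coefficient at `x` of the same product without the factor of index `p₀`. -/
def partialProductCoeff (v : A → M) (f : ℕ → F) (p₀ : A) (x : M) : F :=
  ∑ᶠ k ∈ {k : A →₀ ℕ | (k.sum fun p j => j • v p) = x ∧ k p₀ = 0}, k.prod fun _ j => f j

/-- The hypotheses describe (1 - z) / (1 - τ z) = 1 + (τ - 1) z + (τ - 1) τ z² + ⋯, where successive
coefficients have ratio τ except for the first ratio τ - 1. -/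
theorem prod_add_single {f : ℕ → F} {τ : F} (h0 : f 0 = 1) (h1 : f 1 = τ - 1)
    (hs : ∀ j, f (j + 2) = τ * f (j + 1)) (k : A →₀ ℕ) (p₀ : A) :
    ((k + Finsupp.single p₀ 1).prod fun _ j => f j) =
      (if k p₀ = 0 then τ - 1 else τ) * k.prod fun _ j => f j := by
  classical
  rw [← Finsupp.mul_prod_erase' (k + Finsupp.single p₀ 1) p₀ (fun _ j => f j) (fun _ => h0),
    ← Finsupp.mul_prod_erase' k p₀ (fun _ j => f j) (fun _ => h0), Finsupp.erase_add,
    Finsupp.erase_single, add_zero, ← mul_assoc]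
  congr 1
  simp only [Finsupp.add_apply, Finsupp.single_eq_same]
  rcases h : k p₀ with _ | j
  · simp [h0, h1]
  · simp [hs]

/-- Multiplying the product by 1 - τ e^(v p₀) cancels the denominator of the factor at p₀ and leaves
1 - e^(v p₀) times the remaining factors. Finiteness is needed because an infinite `finsum` could
default to 0. -/
theorem productCoeff_sub {v : A → M} {f : ℕ → F} {τ : F} (h0 : f 0 = 1) (h1 : f 1 = τ - 1)
    (hs : ∀ j, f (j + 2) = τ * f (j + 1))
    (hfin : ∀ x, {k : A →₀ ℕ | (k.sum fun p j => j • v p) = x}.Finite) (p₀ : A) (x : M) :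
    productCoeff v f x - τ * productCoeff v f (x - v p₀) =
      partialProductCoeff v f p₀ x - partialProductCoeff v f p₀ (x - v p₀) := by
  classical
  let T : M → Set (A →₀ ℕ) := fun x => {k | (k.sum fun p j => j • v p) = x}
  let T₀ : M → Set (A →₀ ℕ) := fun x => {k | (k.sum fun p j => j • v p) = x ∧ k p₀ = 0}
  let T₁ : M → Set (A →₀ ℕ) := fun x => {k | (k.sum fun p j => j • v p) = x ∧ k p₀ ≠ 0}
  let w : (A →₀ ℕ) → F := fun k => k.prod fun _ j => f j
  have hT₀ : ∀ x, (T₀ x).Finite := fun x => (hfin x).subset fun k hk => hk.1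
  have hT₁ : ∀ x, (T₁ x).Finite := fun x => (hfin x).subset fun k hk => hk.1
  have hdisj : ∀ x, Disjoint (T₀ x) (T₁ x) := fun x =>
    Set.disjoint_left.mpr fun k hk hk' => hk'.2 hk.2
  have hunion : ∀ x, T x = T₀ x ∪ T₁ x := by
    intro x
    ext k
    simp only [T, T₀, T₁, Set.mem_union, Set.mem_ofPred_eq]
    tauto
  have hsplit : ∀ x, productCoeff v f x =
      partialProductCoeff v f p₀ x + ∑ᶠ k ∈ T₁ x, w k := by
    intro x
    change ∑ᶠ k ∈ T x, w k = ∑ᶠ k ∈ T₀ x, w k + _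
    rw [hunion, finsum_mem_union (hdisj x) (hT₀ x) (hT₁ x)]
  have hsum : ∀ k : A →₀ ℕ, ((k + Finsupp.single p₀ 1).sum fun p j => j • v p) =
      (k.sum fun p j => j • v p) + v p₀ := by
    intro k
    rw [Finsupp.sum_add_index' (h := fun p j => j • v p) (fun _ => zero_nsmul _)
      (fun _ _ _ => add_nsmul _ _ _)]
    simp
  -- Raising the exponent at p₀ by one matches all expansions of x - v p₀ with the expansions of x
  -- that use p₀.
  have hbij : Set.BijOn (fun k : A →₀ ℕ => k + Finsupp.single p₀ 1) (T (x - v p₀)) (T₁ x) := by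
    refine ⟨fun k hk => ⟨?_, by simp⟩, fun a _ b _ h => add_right_cancel h, fun k hk => ?_⟩
    · rw [hsum, show (k.sum fun p j => j • v p) = x - v p₀ from hk, sub_add_cancel]
    · have hle : Finsupp.single p₀ 1 ≤ k := by
        rw [Finsupp.single_le_iff]
        exact Nat.one_le_iff_ne_zero.mpr hk.2
      refine ⟨k - Finsupp.single p₀ 1, ?_, tsub_add_cancel_of_le hle⟩
      have h := hsum (k - Finsupp.single p₀ 1)
      rw [tsub_add_cancel_of_le hle, hk.1] at h
      exact eq_sub_of_add_eq h.symm
  have hT₁sum : ∑ᶠ k ∈ T₁ x, w k =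
      ∑ᶠ k ∈ T (x - v p₀), (if k p₀ = 0 then τ - 1 else τ) * w k :=
    (finsum_mem_eq_of_bijOn _ hbij fun k _ => (prod_add_single h0 h1 hs k p₀).symm).symm
  have e0 : ∑ᶠ k ∈ T₀ (x - v p₀), (if k p₀ = 0 then τ - 1 else τ) * w k =
      (τ - 1) * partialProductCoeff v f p₀ (x - v p₀) := by
    change _ = (τ - 1) * ∑ᶠ k ∈ T₀ (x - v p₀), w k
    rw [mul_finsum_mem]
    exact finsum_mem_congr rfl fun k hk => by rw [if_pos hk.2]
  have e1 : ∑ᶠ k ∈ T₁ (x - v p₀), (if k p₀ = 0 then τ - 1 else τ) * w k =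
      τ * ∑ᶠ k ∈ T₁ (x - v p₀), w k := by
    rw [mul_finsum_mem]
    exact finsum_mem_congr rfl fun k hk => by rw [if_neg hk.2]
  rw [hsplit x, hT₁sum, hunion, finsum_mem_union (hdisj _) (hT₀ _) (hT₁ _), e0, e1, hsplit (x - v p₀)]
  ring

/-- The reflection induces an involution of the indices fixing p₀; relabelling exponent vectors
along it preserves their weights. -/
theorem partialProductCoeff_reflect {v : A → M} {f : ℕ → F}
    {p₀ : A} {s : M →+ M} (hs : ∀ x, s (s x) = x) (hv : Function.Injective v)
    (hperm : ∀ p, p ≠ p₀ → ∃ p', p' ≠ p₀ ∧ v p' = s (v p)) (x : M) :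
    partialProductCoeff v f p₀ (s x) = partialProductCoeff v f p₀ x := by
  classical
  have hex : ∀ p, ∃ p', (p ≠ p₀ → p' ≠ p₀ ∧ v p' = s (v p)) ∧ (p = p₀ → p' = p₀) := by
    intro p
    by_cases hp : p = p₀
    · exact ⟨p₀, fun h => absurd hp h, fun _ => rfl⟩
    · obtain ⟨p', h⟩ := hperm p hp
      exact ⟨p', fun _ => h, fun h' => absurd h' hp⟩
  choose g hg hg' using hex
  have hinv : Function.Involutive g := by
    intro p
    by_cases hp : p = p₀
    · rw [hg' p hp, hg' p₀ rfl, hp]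
    · obtain ⟨h1, h2⟩ := hg p hp
      obtain ⟨h3, h4⟩ := hg _ h1
      exact hv (by rw [h4, h2, hs])
  let σ : A ≃ A := hinv.toPerm
  have hσ₀ : σ p₀ = p₀ := hg' p₀ rfl
  have hsum : ∀ k : A →₀ ℕ, k p₀ = 0 →
      ((k.equivMapDomain σ).sum fun p j => j • v p) = s (k.sum fun p j => j • v p) := by
    intro k hk
    rw [Finsupp.sum_equivMapDomain, map_finsuppSum]
    refine Finsupp.sum_congr fun p hp => ?_
    have hp₀ : p ≠ p₀ := fun h => Finsupp.mem_support_iff.mp hp (h ▸ hk)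
    rw [map_nsmul, ← (hg p hp₀).2]
    rfl
  have hσsymm : ∀ p, σ.symm p = σ p := fun _ => rfl
  have hk₀ : ∀ k : A →₀ ℕ, k.equivMapDomain σ p₀ = k p₀ := by
    intro k
    rw [Finsupp.equivMapDomain_apply, hσsymm, hσ₀]
  have hinv' : ∀ k : A →₀ ℕ, (k.equivMapDomain σ).equivMapDomain σ = k := by
    intro k
    ext p
    simp only [Finsupp.equivMapDomain_apply, hσsymm]
    rw [show σ (σ p) = p from hinv p]
  refine (finsum_mem_eq_of_bijOn (fun k : A →₀ ℕ => k.equivMapDomain σ) ⟨?_, ?_, ?_⟩ ?_).symm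
  · rintro k ⟨h1, h2⟩
    exact ⟨by rw [hsum k h2, h1], by rw [hk₀, h2]⟩
  · intro a _ b _ h
    have := congrArg (fun k => Finsupp.equivMapDomain σ k) h
    simpa only [hinv'] using this
  · rintro k ⟨h1, h2⟩
    exact ⟨k.equivMapDomain σ, ⟨by rw [hsum k h2, h1, hs], by rw [hk₀, h2]⟩, hinv' k⟩
  · intro k _
    exact (Finsupp.prod_equivMapDomain σ k fun _ j => f j).symm

/-- The relation between the coefficients of a product of the factors `(1 - z) / (1 - τ z)` which
follows from a reflection that permutes all factors but one and inverts that one. -/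
theorem productCoeff_reflect {v : A → M} {f : ℕ → F} {τ : F} (h0 : f 0 = 1) (h1 : f 1 = τ - 1)
    (hf : ∀ j, f (j + 2) = τ * f (j + 1))
    (hfin : ∀ x, {k : A →₀ ℕ | (k.sum fun p j => j • v p) = x}.Finite)
    {p₀ : A} {s : M →+ M} (hs : ∀ x, s (s x) = x) (hs₀ : s (v p₀) = -v p₀)
    (hv : Function.Injective v)
    (hperm : ∀ p, p ≠ p₀ → ∃ p', p' ≠ p₀ ∧ v p' = s (v p)) (x : M) :
    productCoeff v f (s x) - τ * productCoeff v f (s x - v p₀) +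
      productCoeff v f (x + v p₀) - τ * productCoeff v f x = 0 := by
  -- Since s x - v p₀ = s (x + v p₀), invariance of the partial product makes the right-hand sides
  -- at s x and at x + v p₀ opposite.
  have e1 := productCoeff_sub h0 h1 hf hfin p₀ (s x)
  have e2 := productCoeff_sub h0 h1 hf hfin p₀ (x + v p₀)
  have e3 : s x - v p₀ = s (x + v p₀) := by rw [map_add, hs₀, sub_eq_add_neg]
  rw [add_sub_cancel_right] at e2
  rw [partialProductCoeff_reflect hs hv hperm] at e1
  rw [e3, partialProductCoeff_reflect hs hv hperm] at e1
  rw [e3]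
  linear_combination e1 + e2

end Expansion

/-! ### Dominant roots and existence of the highest root -/

section RootCombinatorics

variable {ι E E' : Type*} [AddCommGroup E] [Module ℚ E] [AddCommGroup E'] [Module ℚ E']
variable {R : RootPairing ι ℚ E E'}

/-- The height as a linear functional. -/
def heightFunctional [R.IsRootSystem] (b : R.Base) : E →ₗ[ℚ] ℚ :=
  b.toWeightBasis.constr ℚ fun _ => (1 : ℚ)

theorem heightFunctional_root [R.IsRootSystem] (b : R.Base) (i : ι) :
    heightFunctional b (R.root i) = b.height i := by
  have hsimple : ∀ j ∈ b.support, heightFunctional b (R.root j) = 1 := by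
    intro j hj
    have h := b.toWeightBasis.constr_basis ℚ (fun _ => (1 : ℚ)) ⟨j, hj⟩
    rwa [RootPairing.Base.toWeightBasis_apply] at h
  obtain ⟨f, -, -, hf⟩ := b.exists_root_eq_sum_int i
  rw [RootPairing.Base.height_eq_sum hf, hf, map_sum, Int.cast_sum]
  refine Finset.sum_congr rfl fun j hj => ?_
  rw [map_zsmul, hsimple j hj]
  simp

/-- The cone of sums of simple roots. -/
abbrev rootCone (b : R.Base) : AddSubmonoid E := AddSubmonoid.closure (R.root '' b.support)

theorem heightFunctional_nonneg [R.IsRootSystem] (b : R.Base) {x : E} (hx : x ∈ rootCone b) :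
    0 ≤ heightFunctional b x ∧ (heightFunctional b x = 0 → x = 0) := by
  induction hx using AddSubmonoid.closure_induction with
  | mem x hx =>
    obtain ⟨i, hi, rfl⟩ := hx
    rw [heightFunctional_root, RootPairing.Base.height_one_of_mem_support hi]
    norm_num
  | zero => simp
  | add x y _ _ hx hy =>
    rw [map_add]
    refine ⟨add_nonneg hx.1 hy.1, fun h => ?_⟩
    rw [hx.2 (by linarith [hx.1, hy.1]), hy.2 (by linarith [hx.1, hy.1]), add_zero]

theorem root_mem_rootCone [R.IsRootSystem] {b : R.Base} {i : ι} (hi : b.IsPos i) :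
    R.root i ∈ rootCone b := by
  refine (b.root_mem_or_neg_mem i).resolve_right fun h => ?_
  have h1 := (heightFunctional_nonneg b h).1
  rw [map_neg, heightFunctional_root] at h1
  have h2 : (0 : ℚ) < b.height i := by exact_mod_cast hi
  linarith

/-- A positive definite symmetric form for which all reflections are orthogonal. -/
theorem exists_invariant_form [Finite ι] (R : RootPairing ι ℚ E E') [R.IsRootSystem] :
    ∃ B : LinearMap.BilinForm ℚ E, (∀ x, x ≠ 0 → 0 < B x x) ∧ (∀ x y, B x y = B y x) ∧
      ∀ x i, 2 * B x (R.root i) = R.coroot' i x * B (R.root i) (R.root i) := by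
  have := Fintype.ofFinite ι
  refine ⟨R.RootForm, fun x hx => ?_, fun x y => by simpa using R.rootForm_symmetric.eq x y,
    fun x i => ?_⟩
  · rw [R.rootForm_apply_apply]
    by_contra h
    apply hx
    rw [R.eq_zero_iff_forall_coroot'_eq_zero]
    intro i
    have h0 : ∑ j, R.coroot' j x * R.coroot' j x = 0 :=
      le_antisymm (not_lt.mp h) (Finset.sum_nonneg fun j _ => mul_self_nonneg _)
    have := (Finset.sum_eq_zero_iff_of_nonneg fun j _ => mul_self_nonneg _).mp h0 i
      (Finset.mem_univ i)
    exact mul_self_eq_zero.mp this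
  -- Invariance of the form under s_i, applied to x and α_i, with s_i α_i = -α_i.
  · have h := R.rootForm_reflection_reflection_apply i x (R.root i)
    rw [R.reflection_apply_self, R.reflection_apply, map_neg, map_sub, map_smul,
      LinearMap.sub_apply, LinearMap.smul_apply, smul_eq_mul] at h
    linarith

theorem root_reflectionPerm_eq [R.IsCrystallographic] (i j : ι) :
    R.root (R.reflectionPerm i j) = R.root j - R.pairingIn ℤ j i • R.root i := by
  rw [R.root_reflectionPerm, R.reflection_apply_root' ℤ]

theorem cast_pairingIn [R.IsCrystallographic] (i j : ι) :
    ((R.pairingIn ℤ i j : ℤ) : ℚ) = R.pairing i j := by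
  simpa using R.algebraMap_pairingIn ℤ i j

theorem height_reflectionPerm [R.IsCrystallographic] (b : R.Base) (i j : ι) :
    b.height (R.reflectionPerm i j) = b.height j - R.pairingIn ℤ j i * b.height i := by
  rw [b.height_add_zsmul (z := -R.pairingIn ℤ j i) (i := j) (j := i)
    (by rw [root_reflectionPerm_eq, neg_smul, sub_eq_add_neg])]
  simp [sub_eq_add_neg]

/-- A root is dominant if its pairings with all simple coroots are nonnegative. -/
def IsDominant [R.IsCrystallographic] (b : R.Base) (β : ι) : Prop :=
  ∀ i ∈ b.support, 0 ≤ R.pairingIn ℤ β i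

theorem form_root_root [R.IsCrystallographic] {B : LinearMap.BilinForm ℚ E}
    (hB : ∀ x i, 2 * B x (R.root i) = R.coroot' i x * B (R.root i) (R.root i)) (i j : ι) :
    2 * B (R.root i) (R.root j) = R.pairingIn ℤ i j * B (R.root j) (R.root j) := by
  rw [hB, R.root_coroot'_eq_pairing, cast_pairingIn]

theorem form_reflectionPerm [R.IsCrystallographic] {B : LinearMap.BilinForm ℚ E}
    (hsymm : ∀ x y, B x y = B y x)
    (hB : ∀ x i, 2 * B x (R.root i) = R.coroot' i x * B (R.root i) (R.root i)) (i j : ι) :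
    B (R.root (R.reflectionPerm i j)) (R.root (R.reflectionPerm i j)) =
      B (R.root j) (R.root j) := by
  have h := form_root_root hB j i
  simp only [root_reflectionPerm_eq, map_sub, map_zsmul, LinearMap.sub_apply, LinearMap.smul_apply,
    zsmul_eq_mul]
  rw [hsymm (R.root i) (R.root j)]
  linear_combination (-(R.pairingIn ℤ j i : ℚ)) * h

theorem IsDominant.form_nonneg [R.IsRootSystem] [R.IsCrystallographic] {b : R.Base}
    {B : LinearMap.BilinForm ℚ E} (hpos : ∀ x, x ≠ 0 → 0 < B x x)
    (hB : ∀ x i, 2 * B x (R.root i) = R.coroot' i x * B (R.root i) (R.root i))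
    {β : ι} (hβ : IsDominant b β) {x : E} (hx : x ∈ rootCone b) : 0 ≤ B (R.root β) x := by
  induction hx using AddSubmonoid.closure_induction with
  | mem x hx =>
    obtain ⟨i, hi, rfl⟩ := hx
    have h1 := form_root_root hB β i
    have h2 := hpos _ (R.ne_zero i)
    have h3 : (0 : ℚ) ≤ R.pairingIn ℤ β i := by exact_mod_cast hβ i hi
    nlinarith
  | zero => simp
  | add x y _ _ hx hy => rw [map_add]; exact add_nonneg hx hy

theorem IsDominant.isPos [Finite ι] [R.IsRootSystem] [R.IsCrystallographic] {b : R.Base}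
    {β : ι} (hβ : IsDominant b β) : b.IsPos β := by
  obtain ⟨B, hpos, -, hB⟩ := exists_invariant_form R
  rcases b.root_mem_or_neg_mem β with h | h
  · have h1 := heightFunctional_nonneg b h
    rw [heightFunctional_root] at h1
    rw [RootPairing.Base.isPos_iff']
    exact_mod_cast h1.1
  · have h1 := hβ.form_nonneg hpos hB h
    rw [map_neg] at h1
    linarith [hpos _ (R.ne_zero β)]

theorem exists_height_lt_of_not_isDominant [R.IsCrystallographic] {b : R.Base} {β : ι}
    (hβ : ¬ IsDominant b β) :
    ∃ γ, R.root γ - R.root β ∈ rootCone b ∧ b.height β < b.height γ := by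
  simp only [IsDominant, not_forall, not_le] at hβ
  obtain ⟨i, hi, h⟩ := hβ
  refine ⟨R.reflectionPerm i β, ?_, ?_⟩
  · obtain ⟨n, hn⟩ := Int.eq_ofNat_of_zero_le (neg_nonneg.mpr h.le)
    have e : R.root (R.reflectionPerm i β) - R.root β = n • R.root i := by
      rw [root_reflectionPerm_eq, sub_sub_cancel_left, ← neg_smul, hn, natCast_zsmul]
    rw [e]
    exact nsmul_mem (AddSubmonoid.subset_closure (Set.mem_image_of_mem _ hi)) _
  · rw [height_reflectionPerm, RootPairing.Base.height_one_of_mem_support hi]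
    lia

/-- Let S be the set of simple roots occurring in β. For a simple α_i outside S, the pairing ⟨β,
α_i^∨⟩ is a sum of nonpositive terms, yet is nonnegative by dominance; so α_i is orthogonal to S.
The span of S is therefore stable under all simple reflections, and irreducibility makes it the
whole space. -/
theorem IsDominant.exists_sum [Finite ι] [R.IsRootSystem] [R.IsCrystallographic]
    [R.IsReduced] [R.IsIrreducible] {b : R.Base} {β : ι} (hβ : IsDominant b β) :
    ∃ f : ι → ℕ, R.root β = ∑ j ∈ b.support, f j • R.root j ∧ ∀ j ∈ b.support, 0 < f j := by
  classical
  have hpos := hβ.isPos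
  obtain ⟨f, hf, hsum⟩ := b.exists_root_eq_sum_nat_or_neg β
  have hsum' : R.root β = ∑ j ∈ b.support, f j • R.root j := by
    refine hsum.resolve_right fun h => ?_
    have h1 : b.height β = ∑ j ∈ b.support, -(f j : ℤ) :=
      RootPairing.Base.height_eq_sum (by simp [h])
    have h2 : ∑ j ∈ b.support, -(f j : ℤ) ≤ 0 := Finset.sum_nonpos fun j _ => by lia
    rw [RootPairing.Base.isPos_iff] at hpos
    lia
  refine ⟨f, hsum', ?_⟩
  by_contra! hcon
  obtain ⟨i₀, hi₀, hfi₀⟩ := hcon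
  set S : Set ι := {j | j ∈ b.support ∧ 0 < f j} with hS
  have htop : Submodule.span ℚ (R.root '' S) = ⊤ := by
    refine RootPairing.IsIrreducible.eq_top_of_invtSubmodule_reflection (P := R) _
      ((b.forall_mem_support_invtSubmodule_iff _).mp fun i hi => ?_) ?_
    · by_cases hiS : i ∈ S
      · exact Submodule.mem_invtSubmodule_reflection_of_mem _ _
          (Submodule.subset_span ⟨i, hiS, rfl⟩)
      · have hfi : f i = 0 := by
          by_contra h
          exact hiS ⟨hi, Nat.pos_of_ne_zero h⟩
        have hp : ((R.pairingIn ℤ β i : ℤ) : ℚ)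
            = ∑ j ∈ b.support, (f j : ℚ) * (R.pairingIn ℤ j i : ℤ) := by
          rw [cast_pairingIn, ← R.root_coroot'_eq_pairing, hsum', map_sum]
          refine Finset.sum_congr rfl fun j _ => ?_
          rw [map_nsmul, R.root_coroot'_eq_pairing, cast_pairingIn, nsmul_eq_mul]
        have hle : ∀ j ∈ b.support, (f j : ℚ) * (R.pairingIn ℤ j i : ℤ) ≤ 0 := by
          intro j hj
          by_cases hji : j = i
          · simp [hji, hfi]
          · refine mul_nonpos_of_nonneg_of_nonpos (by positivity) ?_
            exact_mod_cast b.pairingIn_le_zero_of_ne hji hj hi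
        have h0 : ∑ j ∈ b.support, (f j : ℚ) * (R.pairingIn ℤ j i : ℤ) = 0 := by
          refine le_antisymm (Finset.sum_nonpos hle) ?_
          rw [← hp]
          exact_mod_cast hβ i hi
        have hz := (Finset.sum_eq_zero_iff_of_nonpos hle).mp h0
        refine (Module.End.mem_invtSubmodule _).mpr ?_
        rw [Submodule.span_le]
        rintro _ ⟨j, hj, rfl⟩
        have hpz : R.pairing j i = 0 := by
          have h1 := hz j hj.1
          have h2 : (f j : ℚ) ≠ 0 := by exact_mod_cast hj.2.ne'
          rw [← cast_pairingIn]
          exact (mul_eq_zero.mp h1).resolve_left h2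
        change R.reflection i (R.root j) ∈ Submodule.span ℚ (R.root '' S)
        rw [R.reflection_apply_root, hpz, zero_smul, sub_zero]
        exact Submodule.subset_span ⟨j, hj, rfl⟩
    · intro hbot
      have hmem : R.root β ∈ Submodule.span ℚ (R.root '' S) := by
        rw [hsum']
        refine Submodule.sum_mem _ fun j hj => ?_
        rcases Nat.eq_zero_or_pos (f j) with h | h
        · simp [h]
        · exact Submodule.smul_of_tower_mem _ _ (Submodule.subset_span ⟨j, ⟨hj, h⟩, rfl⟩)
      rw [hbot, Submodule.mem_bot] at hmem
      exact R.ne_zero β hmem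
  -- A missing simple root would lie in the span of the others.
  have hlin : LinearIndepOn ℚ R.root (b.support : Set ι) := b.linearIndepOn_root
  have hnot := (linearIndepOn_iff_notMem_span.mp hlin) i₀ hi₀
  apply hnot
  have hsub : R.root '' S ⊆ R.root '' ((b.support : Set ι) \ {i₀}) := by
    refine Set.image_mono fun j hj => ⟨hj.1, ?_⟩
    rintro rfl
    exact absurd hj.2 (by lia)
  exact Submodule.span_mono hsub (htop ▸ Submodule.mem_top)

/-- Let θ have maximal height, and let γ have maximal height among the roots above β; both are
dominant. As γ involves every simple root and θ is nonnegative on all of them and positive on one,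
(θ, γ) > 0. So θ - γ is zero or a root, and the latter is positive by maximality of ht θ. -/
theorem exists_isHighestRoot [Finite ι] [R.IsRootSystem] [R.IsCrystallographic]
    [R.IsReduced] [R.IsIrreducible] (b : R.Base) : ∃ θ, IsHighestRoot b θ := by
  classical
  obtain ⟨B, hBpos, hsymm, hB⟩ := exists_invariant_form R
  have : Nonempty ι := by
    by_contra h
    rw [not_nonempty_iff] at h
    have h1 : Nontrivial E := RootPairing.IsIrreducible.nontrivial R
    obtain ⟨x, hx⟩ := exists_ne (0 : E)
    exact hx (R.eq_zero_iff_forall_coroot'_eq_zero.mpr fun i => h.elim i)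
  obtain ⟨θ, hθ⟩ := Finite.exists_max (fun i => b.height i)
  have hθdom : IsDominant b θ := by
    by_contra h
    obtain ⟨γ, -, hγ⟩ := exists_height_lt_of_not_isDominant h
    exact absurd (hθ γ) (not_le.mpr hγ)
  refine ⟨θ, fun β => ?_⟩
  obtain ⟨γ, hγ, hmax⟩ := Set.exists_max_image {γ | R.root γ - R.root β ∈ rootCone b}
    (fun i => b.height i) (Set.toFinite _) ⟨β, by simp⟩
  have hγ' : R.root γ - R.root β ∈ rootCone b := hγ
  have hγdom : IsDominant b γ := by
    by_contra h
    obtain ⟨δ, hδ, hlt⟩ := exists_height_lt_of_not_isDominant h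
    refine absurd (hmax δ ?_) (not_le.mpr hlt)
    have := add_mem hδ hγ'
    rwa [sub_add_sub_cancel] at this
  obtain ⟨f, hf, hfpos⟩ := hγdom.exists_sum
  obtain ⟨g, hg, -⟩ := hθdom.exists_sum
  have hsimple : ∀ j ∈ b.support, 0 ≤ B (R.root θ) (R.root j) := fun j hj =>
    hθdom.form_nonneg hBpos hB (AddSubmonoid.subset_closure ⟨j, hj, rfl⟩)
  have hform : 0 < B (R.root θ) (R.root γ) := by
    obtain ⟨j, hj, hj'⟩ : ∃ j ∈ b.support, 0 < B (R.root θ) (R.root j) := by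
      by_contra! hcon
      have h1 : B (R.root θ) (R.root θ) ≤ 0 := by
        nth_rw 2 [hg]
        rw [map_sum]
        refine Finset.sum_nonpos fun j hj => ?_
        rw [map_nsmul]
        exact nsmul_nonpos (hcon j hj) _
      exact absurd (hBpos _ (R.ne_zero θ)) (not_lt.mpr h1)
    rw [hf, map_sum]
    refine Finset.sum_pos' (fun k hk => ?_) ⟨j, hj, ?_⟩
    · rw [map_nsmul]
      exact nsmul_nonneg (hsimple k hk) _
    · rw [map_nsmul]
      exact nsmul_pos hj' (hfpos j hj).ne'
  have hpair : 0 < R.pairingIn ℤ θ γ := by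
    have h1 := form_root_root hB θ γ
    have h2 := hBpos _ (R.ne_zero γ)
    have h3 : (0 : ℚ) < R.pairingIn ℤ θ γ := by
      by_contra h
      nlinarith
    exact_mod_cast h3
  have hθγ : R.root θ - R.root γ ∈ rootCone b := by
    by_cases h : θ = γ
    · simp [h]
    · obtain ⟨δ, hδ⟩ := R.root_sub_root_mem_of_pairingIn_pos hpair h
      rw [← hδ]
      refine root_mem_rootCone ?_
      rw [RootPairing.Base.isPos_iff', b.height_sub hδ]
      have := hθ γ
      lia
  have := add_mem hθγ hγ'
  rwa [sub_add_sub_cancel] at this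

/-! ### Pairings with the highest root, and its height -/

section HighestRoot

variable [R.IsRootSystem] {b : R.Base} {θ : ι} (hθ : IsHighestRoot b θ)
include hθ

theorem IsHighestRoot.height_le (β : ι) : b.height β ≤ b.height θ := by
  have h := (heightFunctional_nonneg b (hθ β)).1
  rw [map_sub, heightFunctional_root, heightFunctional_root] at h
  have h' : (b.height β : ℚ) ≤ b.height θ := by linarith
  exact_mod_cast h'

theorem IsHighestRoot.eq_of_height_le {β : ι} (h : b.height θ ≤ b.height β) : β = θ := by
  have h1 := (heightFunctional_nonneg b (hθ β)).2
  rw [map_sub, heightFunctional_root, heightFunctional_root,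
    le_antisymm h (hθ.height_le β), sub_self] at h1
  exact (R.root.injective (sub_eq_zero.mp (h1 rfl))).symm

theorem IsHighestRoot.isDominant [R.IsCrystallographic] : IsDominant b θ := by
  by_contra h
  obtain ⟨γ, -, hγ⟩ := exists_height_lt_of_not_isDominant h
  exact absurd (hθ.height_le γ) (not_le.mpr hγ)

variable [Finite ι] [R.IsCrystallographic]

theorem IsHighestRoot.isPos : b.IsPos θ := hθ.isDominant.isPos

theorem IsHighestRoot.isPos_of_pairingIn_pos {β : ι} (h : 0 < R.pairingIn ℤ β θ) :
    b.IsPos β := by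
  obtain ⟨B, hpos, hsymm, hB⟩ := exists_invariant_form R
  by_contra hβ
  have hmem := (b.root_mem_or_neg_mem β).resolve_left fun hmem => hβ (by
    have h1 := (heightFunctional_nonneg b hmem).1
    rw [heightFunctional_root] at h1
    rw [RootPairing.Base.isPos_iff']
    exact_mod_cast h1)
  have h1 := hθ.isDominant.form_nonneg hpos hB hmem
  have h2 := form_root_root hB β θ
  have h3 := hpos _ (R.ne_zero θ)
  have h4 : (0 : ℚ) < R.pairingIn ℤ β θ := by exact_mod_cast h
  rw [map_neg, hsymm] at h1
  nlinarith

/-- Dominance of β, applied to θ - β in the cone, gives (β, θ) ≥ (β, β) > 0. -/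
theorem IsHighestRoot.pairingIn_pos_of_isDominant {β : ι} (h : IsDominant b β) :
    0 < R.pairingIn ℤ β θ := by
  obtain ⟨B, hpos, hsymm, hB⟩ := exists_invariant_form R
  have h1 := h.form_nonneg hpos hB (hθ β)
  have h2 := form_root_root hB β θ
  have h3 := hpos _ (R.ne_zero θ)
  have h4 := hpos _ (R.ne_zero β)
  rw [map_sub] at h1
  have h5 : (0 : ℚ) < R.pairingIn ℤ β θ := by
    by_contra h
    nlinarith
  exact_mod_cast h5

/-- With p = ⟨β, θ^∨⟩, the root s_θ(-β) = pθ - β has height at most ht θ. If p ≥ 2, this forces ht β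
≥ ht θ, hence β = θ. -/
theorem IsHighestRoot.pairingIn_le_one {β : ι} (h : β ≠ θ) : R.pairingIn ℤ β θ ≤ 1 := by
  by_contra! hlt
  have h1 := hθ.height_le (R.reflectionPerm θ (R.reflectionPerm β β))
  have h2 := hθ.isPos
  rw [RootPairing.Base.isPos_iff] at h2
  have h3 := b.height_reflectionPerm_self β
  change b.height (R.reflectionPerm β β) = _ at h3
  rw [height_reflectionPerm, R.pairingIn_reflectionPerm_self_left, h3] at h1
  exact h (hθ.eq_of_height_le (by nlinarith))

theorem IsHighestRoot.neg_one_le_pairingIn {β : ι} (h : β ≠ R.reflectionPerm θ θ) :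
    -1 ≤ R.pairingIn ℤ β θ := by
  have h1 := hθ.pairingIn_le_one (β := R.reflectionPerm β β) (by
    rintro rfl
    apply h
    rw [← R.root_eq_neg_iff]
    simp [R.root_reflectionPerm])
  rw [R.pairingIn_reflectionPerm_self_left] at h1
  lia

/-- The largest exponent counts the heights that occur. All of 1, …, ht θ occur, because a positive
root is built up from a simple one by adding simple roots one at a time through roots. -/
theorem IsHighestRoot.exponent_rank : (exponent b (rank b) : ℤ) = b.height θ := by
  have hdesc : ∀ i, b.IsPos i → ∀ n : ℤ, 1 ≤ n → n ≤ b.height i → ∃ j, b.height j = n := by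
    intro i hi
    refine hi.induction_on_add (p := fun i => ∀ n : ℤ, 1 ≤ n → n ≤ b.height i →
      ∃ j, b.height j = n) ?_ ?_
    · intro i hi n h1 h2
      exact ⟨i, by rw [RootPairing.Base.height_one_of_mem_support hi] at h2 ⊢; lia⟩
    · intro i j k hk ih hj n h1 h2
      rcases eq_or_lt_of_le h2 with h | h
      · exact ⟨k, h.symm⟩
      · rw [b.height_add hk, RootPairing.Base.height_one_of_mem_support hj] at h
        exact ih n h1 (by lia)
  have hset : {n : ℕ | 1 ≤ n ∧ rank b + 1 - rank b ≤ numRootsOfHeight b n} =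
      Set.Icc 1 (b.height θ).toNat := by
    ext n
    rw [Set.mem_ofPred_eq, Set.mem_Icc, Nat.add_sub_cancel_left, numRootsOfHeight,
      Nat.one_le_iff_ne_zero (n := Set.ncard _), ← Nat.pos_iff_ne_zero, Set.ncard_pos]
    refine and_congr_right fun hn => ⟨?_, fun h => ?_⟩
    · rintro ⟨j, -, hj⟩
      have := hθ.height_le j
      lia
    · obtain ⟨j, hj⟩ := hdesc θ hθ.isPos n (by lia) (by lia)
      exact ⟨j, by rw [RootPairing.Base.isPos_iff]; lia, hj⟩
  have := hθ.isPos
  rw [RootPairing.Base.isPos_iff] at this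
  rw [exponent, hset, Set.ncard_eq_toFinset_card']
  simp
  lia

end HighestRoot

end RootCombinatorics

/-! ### Coefficients of one factor, and coefficients of power series at integer exponents -/

/-- The element `t⁻²` of `ℚ(t)`. -/
def τ : Qt := t₀ ^ (-2 : ℤ)

theorem one_sub_mul_mk_factorCoeff :
    (1 - PowerSeries.C τ * PowerSeries.X) * PowerSeries.mk factorCoeff =
      (1 - PowerSeries.X : PowerSeries Qt) := by
  have h : PowerSeries.mk factorCoeff =
      ((1 - PowerSeries.X) * (1 - PowerSeries.C τ * PowerSeries.X : PowerSeries Qt)⁻¹) := by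
    ext k
    rw [PowerSeries.coeff_mk]
    rfl
  rw [h, mul_left_comm, PowerSeries.mul_inv_cancel _ (by simp), mul_one]

theorem factorCoeff_one : factorCoeff 1 = τ - 1 := by
  have h := congrArg (PowerSeries.coeff 1) one_sub_mul_mk_factorCoeff
  rw [sub_mul, one_mul, mul_assoc, map_sub, PowerSeries.coeff_C_mul,
    PowerSeries.coeff_succ_X_mul, map_sub, PowerSeries.coeff_mk, PowerSeries.coeff_mk,
    factorCoeff_zero, PowerSeries.coeff_one_X, PowerSeries.coeff_one] at h
  simp only [one_ne_zero, if_false] at h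
  linear_combination h

theorem factorCoeff_add_two (j : ℕ) : factorCoeff (j + 2) = τ * factorCoeff (j + 1) := by
  have h := congrArg (PowerSeries.coeff (j + 2)) one_sub_mul_mk_factorCoeff
  rw [sub_mul, one_mul, mul_assoc, map_sub, PowerSeries.coeff_C_mul,
    PowerSeries.coeff_succ_X_mul, map_sub, PowerSeries.coeff_mk, PowerSeries.coeff_mk,
    PowerSeries.coeff_X, PowerSeries.coeff_one] at h
  simp only [Nat.add_eq_zero_iff, OfNat.ofNat_ne_zero, and_false, if_false,
    show j + 2 ≠ 1 by lia, sub_zero] at h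
  linear_combination h

/-- The coefficient of a power series at an integer exponent. -/
def intCoeff (n : ℤ) : PowerSeries Qt →ₗ[Qt] Qt :=
  if 0 ≤ n then PowerSeries.coeff n.toNat else 0

theorem intCoeff_natCast (n : ℕ) (F : PowerSeries Qt) :
    intCoeff n F = PowerSeries.coeff n F := by
  simp [intCoeff]

theorem intCoeff_of_neg {n : ℤ} (hn : n < 0) (F : PowerSeries Qt) : intCoeff n F = 0 := by
  simp [intCoeff, not_le.mpr hn]

theorem intCoeff_X_mul (n : ℤ) (F : PowerSeries Qt) :
    intCoeff n (PowerSeries.X * F) = intCoeff (n - 1) F := by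
  rcases lt_or_ge n 0 with h | h
  · rw [intCoeff_of_neg h, intCoeff_of_neg (by lia)]
  · obtain ⟨k, rfl⟩ := Int.eq_ofNat_of_zero_le h
    rcases k with _ | k
    · rw [intCoeff_of_neg (n := ((0 : ℕ) : ℤ) - 1) (by simp), intCoeff_natCast]
      simp
    · rw [intCoeff_natCast, show ((k + 1 : ℕ) : ℤ) - 1 = (k : ℕ) by push_cast; ring,
        intCoeff_natCast, PowerSeries.coeff_succ_X_mul]

theorem ext_intCoeff {F G : PowerSeries Qt} (h : ∀ n : ℤ, intCoeff n F = intCoeff n G) : F = G := by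
  ext n
  simpa only [intCoeff_natCast] using h n

/-! ### Affine roots and the relations between coefficients of C -/

section Relations

variable {ι E E' : Type*} [AddCommGroup E] [Module ℚ E] [AddCommGroup E'] [Module ℚ E']
variable {R : RootPairing ι ℚ E E'}

theorem chi_of_isPos {b : R.Base} {α : ι} (h : b.IsPos α) : chi b α = 0 := by
  simp [chi, h]

theorem chi_of_not_isPos {b : R.Base} {α : ι} (h : ¬ b.IsPos α) : chi b α = 1 := by
  simp [chi, h]

theorem chi_le_one (b : R.Base) (α : ι) : chi b α ≤ 1 := by
  by_cases h : b.IsPos α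
  · simp [chi_of_isPos h]
  · simp [chi_of_not_isPos h]

/-- The exponent `(-α, i + χ(α))` of the monomial `q^{i + χ(α)} e^{-α}`. -/
def affineRoot (b : R.Base) (p : ι × ℕ) : E × ℚ :=
  (-R.root p.1, ((p.2 + chi b p.1 : ℕ) : ℚ))

theorem affineRoot_injective (b : R.Base) : Function.Injective (affineRoot b) := by
  rintro ⟨α, i⟩ ⟨β, j⟩ h
  obtain ⟨h1, h2⟩ := Prod.ext_iff.mp h
  have h3 : α = β := R.root.injective (neg_injective h1)
  subst h3
  have h4 : i + chi b α = j + chi b α := by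
    have h5 : ((i + chi b α : ℕ) : ℚ) = ((j + chi b α : ℕ) : ℚ) := h2
    exact_mod_cast h5
  rw [Nat.add_right_cancel h4]

/-- Levels are nonnegative, so opposite affine roots would both have level 0; then both underlying
roots are positive, and they cannot be opposite. -/
theorem affineRoot_ne_neg (b : R.Base) (p p' : ι × ℕ) : affineRoot b p ≠ -affineRoot b p' := by
  intro h
  obtain ⟨h1, h2⟩ := Prod.ext_iff.mp h
  have h3 : ((p.2 + chi b p.1 : ℕ) : ℚ) = -((p'.2 + chi b p'.1 : ℕ) : ℚ) := h2
  have h4 : (p.2 + chi b p.1) + (p'.2 + chi b p'.1) = 0 := by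
    rw [eq_neg_iff_add_eq_zero] at h3
    exact_mod_cast h3
  have hpos : ∀ α, chi b α = 0 → b.IsPos α := by
    intro α hα
    by_contra h
    rw [chi_of_not_isPos h] at hα
    exact one_ne_zero hα
  have h5 := hpos p.1 (by lia)
  have h6 := hpos p'.1 (by lia)
  have h7 : R.root p.1 = -R.root p'.1 := neg_injective h1
  rw [R.root_eq_neg_iff] at h7
  rw [h7] at h5
  have h8 := b.height_reflectionPerm_self p'.1
  change b.height (R.reflectionPerm p'.1 p'.1) = _ at h8
  rw [RootPairing.Base.isPos_iff] at h5 h6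
  lia

theorem sum_affineRoot (b : R.Base) (k : ι × ℕ →₀ ℕ) :
    (k.sum fun p j => j • affineRoot b p) =
      (k.sum fun p j => j • -R.root p.1,
        ((k.sum fun p j => j * (p.2 + chi b p.1) : ℕ) : ℚ)) := by
  refine Prod.ext ?_ ?_
  · rw [Finsupp.sum, Prod.fst_sum]
    rfl
  · rw [Finsupp.sum, Prod.snd_sum]
    change _ = ((∑ p ∈ k.support, k p * (p.2 + chi b p.1) : ℕ) : ℚ)
    rw [Nat.cast_sum]
    refine Finset.sum_congr rfl fun p _ => ?_
    rw [Prod.smul_snd, affineRoot, nsmul_eq_mul, Nat.cast_mul]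

theorem productCoeff_affineRoot (b : R.Base) (μ : E) (n : ℤ) :
    productCoeff (affineRoot b) factorCoeff (μ, (n : ℚ)) = intCoeff n (kernel b μ) := by
  rw [productCoeff]
  rcases lt_or_ge n 0 with h | h
  · rw [intCoeff_of_neg h]
    refine finsum_mem_eq_zero_of_forall_eq_zero fun k hk => ?_
    have h1 := congrArg Prod.snd (show _ = _ from hk)
    rw [sum_affineRoot] at h1
    dsimp only at h1
    have h2 : (((k.sum fun p j => j * (p.2 + chi b p.1) : ℕ) : ℤ) : ℚ) = n := by
      rw [Int.cast_natCast, h1]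
    have h3 := Int.cast_injective h2
    lia
  · obtain ⟨n, rfl⟩ := Int.eq_ofNat_of_zero_le h
    rw [intCoeff_natCast, kernel, PowerSeries.coeff_mk, kernelCoeff]
    refine finsum_mem_congr (Set.ext fun k => ?_) fun _ _ => rfl
    rw [Set.mem_ofPred_eq, expansions, Set.mem_ofPred_eq, sum_affineRoot, Prod.ext_iff]
    simp only [Int.cast_natCast, Nat.cast_inj]

theorem finite_setOf_sum_affineRoot [Finite ι] [R.IsRootSystem] (b : R.Base) (x : E × ℚ) :
    {k : ι × ℕ →₀ ℕ | (k.sum fun p j => j • affineRoot b p) = x}.Finite := by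
  rcases Set.eq_empty_or_nonempty
    {k : ι × ℕ →₀ ℕ | (k.sum fun p j => j • affineRoot b p) = x} with h | ⟨k₀, hk₀⟩
  · rw [h]
    exact Set.finite_empty
  -- The level x.2 is only rational; any one expansion exhibits it as a natural number.
  · refine (finite_expansions b x.1 (k₀.sum fun p j => j * (p.2 + chi b p.1))).subset ?_
    intro k hk
    rw [Set.mem_ofPred_eq] at hk hk₀
    have h1 := congrArg Prod.fst hk
    have h2 := congrArg Prod.snd (hk.trans hk₀.symm)
    rw [sum_affineRoot] at h1
    rw [sum_affineRoot, sum_affineRoot] at h2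
    dsimp only at h2
    exact ⟨h1, by exact_mod_cast h2⟩

/-- The linear reflection `(μ, n) ↦ (s_i μ, n - ε ⟨μ, α_i^∨⟩)`. -/
def affineReflection (R : RootPairing ι ℚ E E') (i : ι) (ε : ℚ) : E × ℚ →+ E × ℚ where
  toFun x := (R.reflection i x.1, x.2 - ε * R.coroot' i x.1)
  map_zero' := by simp
  map_add' x y := by
    refine Prod.ext ?_ ?_
    · simp
    · simp only [Prod.fst_add, Prod.snd_add, map_add]
      ring

theorem affineReflection_apply (i : ι) (ε : ℚ) (x : E × ℚ) :
    affineReflection R i ε x = (R.reflection i x.1, x.2 - ε * R.coroot' i x.1) := rfl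

theorem affineReflection_self (i : ι) (ε : ℚ) (x : E × ℚ) :
    affineReflection R i ε (affineReflection R i ε x) = x := by
  refine Prod.ext ?_ ?_
  · simp [affineReflection_apply]
  · simp only [affineReflection_apply]
    rw [R.reflection_apply, map_sub, map_smul, R.root_coroot'_eq_pairing, R.pairing_same,
      smul_eq_mul]
    ring

/-- The relation between the coefficients of `C_{q,t}` given by an affine simple reflection. -/
theorem productCoeff_affineRoot_reflect [Finite ι] [R.IsRootSystem] [R.IsCrystallographic]
    (b : R.Base) (i : ι) (ε : ℤ) (p₀ : ι × ℕ)
    (h₀ : affineReflection R i ε (affineRoot b p₀) = -affineRoot b p₀)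
    (hperm : ∀ p, p ≠ p₀ → (chi b (R.reflectionPerm i p.1) : ℤ) ≤
      p.2 + chi b p.1 + ε * R.pairingIn ℤ p.1 i) (x : E × ℚ) :
    productCoeff (affineRoot b) factorCoeff (affineReflection R i ε x) -
      τ * productCoeff (affineRoot b) factorCoeff (affineReflection R i ε x - affineRoot b p₀) +
      productCoeff (affineRoot b) factorCoeff (x + affineRoot b p₀) -
      τ * productCoeff (affineRoot b) factorCoeff x = 0 := by
  refine productCoeff_reflect factorCoeff_zero factorCoeff_one factorCoeff_add_two
    (finite_setOf_sum_affineRoot b) (affineReflection_self i ε) h₀ (affineRoot_injective b)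
    (fun p hp => ?_) x
  -- N is the index i of the reflected affine root; the hypothesis says exactly that it is
  -- nonnegative.
  obtain ⟨N, hN⟩ := Int.eq_ofNat_of_zero_le (sub_nonneg.mpr (hperm p hp))
  have hv : affineRoot b (R.reflectionPerm i p.1, N) = affineReflection R i ε (affineRoot b p) := by
    refine Prod.ext ?_ ?_
    · simp [affineRoot, affineReflection_apply, R.root_reflectionPerm]
    · simp only [affineRoot, affineReflection_apply, map_neg, R.root_coroot'_eq_pairing]
      rw [← cast_pairingIn]
      have hN' : ((N : ℤ) : ℚ) = ((p.2 + chi b p.1 + ε * R.pairingIn ℤ p.1 i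
        - chi b (R.reflectionPerm i p.1) : ℤ) : ℚ) := by rw [hN]
      push_cast at hN' ⊢
      linarith
  refine ⟨_, ?_, hv⟩
  -- If p were sent to the affine root of p₀, then p would have the opposite affine root.
  intro h
  rw [h] at hv
  apply affineRoot_ne_neg b p p₀
  rw [← affineReflection_self (R := R) i ε (affineRoot b p), ← hv, h₀]

variable [Finite ι] [R.IsRootSystem] [R.IsCrystallographic]

/-- The relation given by a simple reflection. -/
theorem kernel_reflection [R.IsReduced] (b : R.Base) {i : ι} (hi : i ∈ b.support) (μ : E) :
    kernel b (R.reflection i μ) - τ • kernel b (R.reflection i μ + R.root i) +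
      kernel b (μ - R.root i) - τ • kernel b μ = 0 := by
  have hipos : b.IsPos i := RootPairing.Base.isPos_of_mem_support hi
  have hroot : affineRoot b (i, 0) = (-R.root i, 0) := by
    simp [affineRoot, chi_of_isPos hipos]
  refine ext_intCoeff fun n => ?_
  have h := productCoeff_affineRoot_reflect b i 0 (i, 0) (by
    rw [hroot]
    simp [affineReflection_apply]) (fun p hp => ?_) (μ, (n : ℚ))
  · simp only [hroot, affineReflection_apply, Int.cast_zero, zero_mul, sub_zero, Prod.mk_add_mk,
      Prod.mk_sub_mk, sub_neg_eq_add, add_zero, ← sub_eq_add_neg, productCoeff_affineRoot] at h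
    simpa only [map_sub, map_add, map_smul, smul_eq_mul, map_zero] using h
  · rw [zero_mul, add_zero]
    have h1 := chi_le_one b (R.reflectionPerm i p.1)
    by_cases hpi : p.1 = i
    · have h2 : p.2 ≠ 0 := fun h2 => hp (Prod.ext hpi h2)
      lia
    · by_cases hpos : b.IsPos p.1
      · rw [chi_of_isPos (hpos.reflectionPerm hi hpi)]
        positivity
      · rw [chi_of_not_isPos hpos]
        lia

theorem IsHighestRoot.affineRoot_eq {b : R.Base} {θ : ι} (hθ : IsHighestRoot b θ) :
    affineRoot b (R.reflectionPerm θ θ, 0) = (R.root θ, 1) := by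
  have h : ¬ b.IsPos (R.reflectionPerm θ θ) := by
    have h1 := b.height_reflectionPerm_self θ
    change b.height (R.reflectionPerm θ θ) = _ at h1
    have h2 := hθ.isPos
    rw [RootPairing.Base.isPos_iff] at h2 ⊢
    lia
  simp [affineRoot, chi_of_not_isPos h, R.root_reflectionPerm]

/-- The relation given by the affine simple reflection. -/
theorem IsHighestRoot.productCoeff_reflect {b : R.Base} {θ : ι} (hθ : IsHighestRoot b θ)
    (x : E × ℚ) :
    productCoeff (affineRoot b) factorCoeff (affineReflection R θ 1 x) -
      τ * productCoeff (affineRoot b) factorCoeff (affineReflection R θ 1 x - (R.root θ, 1)) +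
      productCoeff (affineRoot b) factorCoeff (x + (R.root θ, 1)) -
      τ * productCoeff (affineRoot b) factorCoeff x = 0 := by
  rw [← hθ.affineRoot_eq]
  have h1 : (1 : ℚ) = ((1 : ℤ) : ℚ) := by simp
  rw [h1]
  refine productCoeff_affineRoot_reflect b θ 1 (R.reflectionPerm θ θ, 0) ?_ (fun p hp => ?_) x
  · rw [hθ.affineRoot_eq]
    refine Prod.ext ?_ ?_
    · simp [affineReflection_apply]
    · simp only [affineReflection_apply, R.root_coroot'_eq_pairing, R.pairing_same]
      norm_num
  · rw [one_mul]
    have hchi := chi_le_one b (R.reflectionPerm θ p.1)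
    have hpair : R.pairingIn ℤ (R.reflectionPerm θ p.1) θ = -R.pairingIn ℤ p.1 θ := by
      rw [← R.pairingIn_reflectionPerm, R.pairingIn_reflectionPerm_self_right]
    -- Only a negative pairing lowers the level. Then α is negative and s_θ α positive, so the
    -- starting level is at least 1 and the final one need only be nonnegative. The drop is 1,
    -- except for α = -θ, where it is 2 and the excluded index leaves level at least 2.
    rcases lt_trichotomy (R.pairingIn ℤ p.1 θ) 0 with hneg | hzero | hpos
    · have h2 : chi b (R.reflectionPerm θ p.1) = 0 :=
        chi_of_isPos (hθ.isPos_of_pairingIn_pos (by rw [hpair]; lia))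
      have h3 : ¬ b.IsPos p.1 := by
        intro hcon
        have h4 := hθ.isPos_of_pairingIn_pos (β := R.reflectionPerm p.1 p.1) (by
          rw [R.pairingIn_reflectionPerm_self_left]; lia)
        have h5 := b.height_reflectionPerm_self p.1
        change b.height (R.reflectionPerm p.1 p.1) = _ at h5
        rw [RootPairing.Base.isPos_iff] at h4 hcon
        lia
      rw [h2, chi_of_not_isPos h3]
      by_cases hpθ : p.1 = R.reflectionPerm θ θ
      · have h6 : p.2 ≠ 0 := fun h => hp (Prod.ext hpθ h)
        rw [hpθ, R.pairingIn_reflectionPerm_self_left, R.pairingIn_same]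
        lia
      · have := hθ.neg_one_le_pairingIn hpθ
        lia
    · have h2 : R.reflectionPerm θ p.1 = p.1 := by
        apply R.root.injective
        rw [root_reflectionPerm_eq, hzero, zero_smul, sub_zero]
      rw [h2]
      lia
    · lia

/-- The affine reflection sends (γ, n - 1) to (β, n) = (γ, n - 1) + (θ, 1), so the four terms of the
relation coincide in pairs. -/
theorem IsHighestRoot.kernel_root {b : R.Base} {θ : ι} (hθ : IsHighestRoot b θ) {β γ : ι}
    (hβ : R.pairingIn ℤ β θ = 1) (hγ : R.root γ = R.root β - R.root θ) :
    kernel b (R.root β) = τ • (PowerSeries.X * kernel b (R.root γ)) := by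
  refine ext_intCoeff fun n => ?_
  rw [map_smul, intCoeff_X_mul, smul_eq_mul]
  have hpair : R.coroot' θ (R.root γ) = -1 := by
    rw [hγ, map_sub, R.root_coroot'_eq_pairing, R.root_coroot'_eq_pairing, R.pairing_same,
      ← cast_pairingIn, hβ]
    norm_num
  have hs : affineReflection R θ 1 (R.root γ, ((n - 1 : ℤ) : ℚ)) = (R.root β, (n : ℚ)) := by
    refine Prod.ext ?_ ?_
    · simp only [affineReflection_apply]
      rw [R.reflection_apply, hpair, hγ]
      module
    · simp only [affineReflection_apply, hpair]
      push_cast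
      ring
  have h := hθ.productCoeff_reflect (R.root γ, ((n - 1 : ℤ) : ℚ))
  have e1 : ((R.root β, (n : ℚ)) : E × ℚ) - (R.root θ, 1) = (R.root γ, ((n - 1 : ℤ) : ℚ)) :=
    Prod.ext (by simp [hγ]) (by simp)
  rw [hs, ← e1, sub_add_cancel, e1, productCoeff_affineRoot, productCoeff_affineRoot] at h
  linear_combination h / 2

/-- The affine reflection fixes (0, n - 1), so two terms of the relation there merge. -/
theorem IsHighestRoot.kernel_zero {b : R.Base} {θ : ι} (hθ : IsHighestRoot b θ) :
    kernel b (R.root θ) + (1 - τ) • (PowerSeries.X * kernel b 0) =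
      τ • (PowerSeries.X * (PowerSeries.X * kernel b (-R.root θ))) := by
  refine ext_intCoeff fun n => ?_
  simp only [map_add, map_smul, intCoeff_X_mul, smul_eq_mul]
  have h := hθ.productCoeff_reflect (0, ((n - 1 : ℤ) : ℚ))
  have hs : affineReflection R θ 1 (0, ((n - 1 : ℤ) : ℚ)) = (0, ((n - 1 : ℤ) : ℚ)) := by
    simp [affineReflection_apply]
  have e1 : ((0, ((n - 1 : ℤ) : ℚ)) : E × ℚ) - (R.root θ, 1) =
      (-R.root θ, ((n - 1 - 1 : ℤ) : ℚ)) := Prod.ext (by simp) (by simp)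
  have e2 : ((0, ((n - 1 : ℤ) : ℚ)) : E × ℚ) + (R.root θ, 1) = (R.root θ, (n : ℚ)) :=
    Prod.ext (by simp) (by simp)
  rw [hs, e1, e2, productCoeff_affineRoot, productCoeff_affineRoot, productCoeff_affineRoot] at h
  linear_combination h

end Relations

/-! ### Uniqueness and explicit solution of the relations -/

section Solution

variable {ι E E' : Type*} [AddCommGroup E] [Module ℚ E] [AddCommGroup E'] [Module ℚ E']
variable {R : RootPairing ι ℚ E E'}
variable [Finite ι] [R.IsRootSystem] [R.IsCrystallographic]

/-- The homogeneous system of relations given by the affine simple reflections has no nonzero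
solution. -/
theorem IsHighestRoot.eq_zero_of_relations {b : R.Base} {θ : ι} (hθ : IsHighestRoot b θ)
    {w : ι → PowerSeries Qt}
    (hsimple : ∀ i ∈ b.support, w (R.reflectionPerm i i) = τ • w i)
    (hfin : ∀ i ∈ b.support, ∀ β γ, R.root γ = R.root β - R.root i →
      w (R.reflectionPerm i β) - τ • w (R.reflectionPerm i γ) + w γ - τ • w β = 0)
    (haff : ∀ β γ, R.pairingIn ℤ β θ = 1 → R.root γ = R.root β - R.root θ →
      w β = τ • (PowerSeries.X * w γ))
    (haffθ : w θ = τ • (PowerSeries.X * (PowerSeries.X * w (R.reflectionPerm θ θ))))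
    (β : ι) : w β = 0 := by
  obtain ⟨B, hpos, hsymm, hB⟩ := exists_invariant_form R
  ext n
  rw [map_zero]
  induction n using Nat.strong_induction_on generalizing β with
  | _ n ihn =>
  have hX : ∀ γ, PowerSeries.coeff n (PowerSeries.X * w γ) = 0 := by
    intro γ
    rcases n with _ | n
    · simp
    · rw [PowerSeries.coeff_succ_X_mul, ihn n (by lia)]
  -- On roots pairing positively with θ, the affine relations give a factor q, which reduces to
  -- lower order.
  have hpair : ∀ β, 0 < R.pairingIn ℤ β θ → PowerSeries.coeff n (w β) = 0 := by
    intro β hβ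
    by_cases hβθ : β = θ
    · rw [hβθ, haffθ, map_smul]
      rcases n with _ | n
      · simp
      · rw [PowerSeries.coeff_succ_X_mul]
        rcases n with _ | n
        · simp
        · rw [PowerSeries.coeff_succ_X_mul, ihn n (by lia), smul_zero]
    · obtain ⟨γ, hγ⟩ := R.root_sub_root_mem_of_pairingIn_pos hβ hβθ
      have h1 := hθ.pairingIn_le_one hβθ
      rw [haff β γ (by lia) hγ, map_smul, hX, smul_zero]
  let N : ι → ℚ := fun β => B (R.root β) (R.root β)
  have hN : ∀ i β, N (R.reflectionPerm i β) = N β := form_reflectionPerm hsymm hB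
  -- Shorter roots come first and, at equal length, higher ones. The dominant roots, where no simple
  -- reflection raises the height, are covered by `hpair`.
  let r : ι → ι → Prop := fun γ β => N γ < N β ∨ (N γ = N β ∧ b.height β < b.height γ)
  have : IsTrans ι r := ⟨by
    rintro x y z (h1 | ⟨h1, h1'⟩) (h2 | ⟨h2, h2'⟩)
    · exact Or.inl (h1.trans h2)
    · exact Or.inl (h2 ▸ h1)
    · exact Or.inl (h1 ▸ h2)
    · exact Or.inr ⟨h1.trans h2, h2'.trans h1'⟩⟩
  have : Std.Irrefl r := ⟨by
    rintro x (h | ⟨-, h⟩) <;> exact lt_irrefl _ h⟩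
  have hwf : WellFounded r := Finite.wellFounded_of_trans_of_irrefl r
  induction β using hwf.induction with
  | _ β ih =>
  by_cases hdom : IsDominant b β
  · exact hpair β (hθ.pairingIn_pos_of_isDominant hdom)
  simp only [IsDominant, not_forall, not_le] at hdom
  obtain ⟨i, hi, hneg⟩ := hdom
  obtain ⟨μ, rfl⟩ : ∃ μ, β = R.reflectionPerm i μ :=
    ⟨R.reflectionPerm i β, (R.reflectionPerm_self i β).symm⟩
  rw [← R.pairingIn_reflectionPerm, R.pairingIn_reflectionPerm_self_right] at hneg
  have hp : 0 < R.pairingIn ℤ μ i := by lia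
  have hμ : PowerSeries.coeff n (w μ) = 0 := by
    refine ih μ (Or.inr ⟨(hN i μ).symm, ?_⟩)
    rw [height_reflectionPerm, RootPairing.Base.height_one_of_mem_support hi]
    lia
  by_cases hμi : μ = i
  · subst hμi
    rw [hsimple μ hi, map_smul, hμ, smul_zero]
  obtain ⟨γ, hγ⟩ := R.root_sub_root_mem_of_pairingIn_pos hp hμi
  have hrel := congrArg (PowerSeries.coeff n) (hfin i hi μ γ hγ)
  simp only [map_sub, map_add, map_smul, map_zero, smul_eq_mul, hμ, mul_zero, sub_zero] at hrel
  -- If the pairing is 1, then γ = μ - α_i is s_i μ itself and its coefficient is its own negative.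
  -- Otherwise the pairing is at least 2, and both γ and s_i γ are strictly shorter than μ.
  rcases eq_or_ne (R.pairingIn ℤ μ i) 1 with hp1 | hp1
  · have hγμ : γ = R.reflectionPerm i μ := by
      apply R.root.injective
      rw [hγ, root_reflectionPerm_eq, hp1, one_smul]
    rw [hγμ, R.reflectionPerm_self, hμ, mul_zero, sub_zero] at hrel
    exact self_eq_neg.mp (eq_neg_of_add_eq_zero_left hrel)
  · have hNγ : N γ < N (R.reflectionPerm i μ) := by
      rw [hN]
      have h1 := form_root_root hB μ i
      have h2 := hpos _ (R.ne_zero i)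
      have h3 : (2 : ℚ) ≤ R.pairingIn ℤ μ i := by exact_mod_cast (by lia : 2 ≤ R.pairingIn ℤ μ i)
      simp only [N, hγ, map_sub, LinearMap.sub_apply]
      rw [hsymm (R.root i) (R.root μ)]
      nlinarith
    rw [ih γ (Or.inl hNγ), ih (R.reflectionPerm i γ) (Or.inl (by rw [hN]; exact hNγ)), mul_zero,
      sub_zero, add_zero] at hrel
    exact hrel

/-- The solution of the relations between the coefficients of `C_{q,t}` at roots: a multiple of
`τ ^ (-ht β)` on positive roots, and another one on negative roots. -/
def heightSolution (b : R.Base) (x y : PowerSeries Qt) (β : ι) : PowerSeries Qt := by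
  classical exact τ ^ (-b.height β) • if b.IsPos β then x else y

theorem τ_ne_zero : τ ≠ 0 := zpow_ne_zero _ RatFunc.X_ne_zero

omit [R.IsRootSystem] [R.IsCrystallographic] [Finite ι] in
theorem heightSolution_of_isPos {b : R.Base} (x y : PowerSeries Qt) {β : ι} (h : b.IsPos β) :
    heightSolution b x y β = τ ^ (-b.height β) • x := by
  simp [heightSolution, h]

omit [R.IsRootSystem] [R.IsCrystallographic] [Finite ι] in
theorem heightSolution_of_not_isPos {b : R.Base} (x y : PowerSeries Qt) {β : ι}
    (h : ¬ b.IsPos β) : heightSolution b x y β = τ ^ (-b.height β) • y := by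
  simp [heightSolution, h]

omit [R.IsRootSystem] [R.IsCrystallographic] [Finite ι] in
-- Subtracting a simple root from another root never crosses between positive and negative roots, so
-- only the power of τ changes.
theorem heightSolution_sub (b : R.Base) (x y : PowerSeries Qt) {i β γ : ι} (hi : i ∈ b.support)
    (h : R.root γ = R.root β - R.root i) :
    heightSolution b x y γ = τ • heightSolution b x y β := by
  have hht : -b.height γ = 1 + -b.height β := by
    rw [b.height_sub h, RootPairing.Base.height_one_of_mem_support hi]
    ring
  by_cases hβ : b.IsPos β
  · rw [heightSolution_of_isPos x y hβ, heightSolution_of_isPos x y (hβ.sub hi h), smul_smul, hht,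
      zpow_one_add₀ τ_ne_zero]
  · have hγ : ¬ b.IsPos γ := fun hγ =>
      hβ (hγ.add (RootPairing.Base.isPos_of_mem_support hi) (by rw [h, sub_add_cancel]))
    rw [heightSolution_of_not_isPos x y hβ, heightSolution_of_not_isPos x y hγ, smul_smul, hht,
      zpow_one_add₀ τ_ne_zero]

omit [R.IsRootSystem] [R.IsCrystallographic] [Finite ι] in
theorem height_reflectionPerm_self' (b : R.Base) (i : ι) :
    b.height (R.reflectionPerm i i) = -b.height i :=
  b.height_reflectionPerm_self i

omit [R.IsRootSystem] [R.IsCrystallographic] [Finite ι] in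
theorem not_isPos_reflectionPerm_self {b : R.Base} {i : ι} (hi : b.IsPos i) :
    ¬ b.IsPos (R.reflectionPerm i i) := by
  rw [RootPairing.Base.isPos_iff] at hi ⊢
  rw [height_reflectionPerm_self']
  lia

/-- The coefficients of C and the explicit solution satisfy the same inhomogeneous relations, whose
inhomogeneity comes from [e^0]C; their difference solves the homogeneous system. The hypothesis `hx`
is the relation at simple roots, `hy` the one at roots pairing to 1 with θ; together they give the
relation at θ. -/
theorem IsHighestRoot.kernel_root_eq [R.IsReduced] {b : R.Base} {θ : ι} (hθ : IsHighestRoot b θ)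
    {x y : PowerSeries Qt} (hx : x = τ • y + (1 - τ) • kernel b 0)
    (hy : x = τ ^ (b.height θ + 1) • (PowerSeries.X * y)) (β : ι) :
    kernel b (R.root β) = heightSolution b x y β := by
  have hneg : ∀ i, R.root (R.reflectionPerm i i) = -R.root i := by
    intro i
    rw [R.root_reflectionPerm, R.reflection_apply_self]
  refine sub_eq_zero.mp (hθ.eq_zero_of_relations
    (w := fun β => kernel b (R.root β) - heightSolution b x y β) ?_ ?_ ?_ ?_ β)
  · intro i hi
    have hpos := RootPairing.Base.isPos_of_mem_support hi
    have h := kernel_reflection b hi (R.root i)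
    rw [R.reflection_apply_self, neg_add_cancel, sub_self] at h
    rw [hneg, heightSolution_of_isPos x y hpos,
      heightSolution_of_not_isPos x y (not_isPos_reflectionPerm_self hpos),
      height_reflectionPerm_self', RootPairing.Base.height_one_of_mem_support hi, neg_neg,
      zpow_one, smul_sub, smul_smul, zpow_neg_one, mul_inv_cancel₀ τ_ne_zero, one_smul, hx]
    rw [← sub_eq_zero] at h ⊢
    rw [← h]
    simp only [sub_smul, one_smul]
    abel
  · intro i hi β γ hγ
    have h := kernel_reflection b hi (R.root β)
    have h1 : R.root (R.reflectionPerm i β) = R.root (R.reflectionPerm i γ) - R.root i := by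
      rw [R.root_reflectionPerm, R.root_reflectionPerm, hγ, map_sub, R.reflection_apply_self]
      abel
    have h2 : R.reflection i (R.root β) + R.root i = R.root (R.reflectionPerm i γ) := by
      rw [← R.root_reflectionPerm, h1, sub_add_cancel]
    rw [h2, ← hγ, ← R.root_reflectionPerm] at h
    rw [heightSolution_sub b x y hi h1, heightSolution_sub b x y hi hγ]
    rw [← h]
    simp only [smul_sub]
    abel
  · intro β γ hβ hγ
    have hβpos := hθ.isPos_of_pairingIn_pos (β := β) (by lia)
    have hht := b.height_sub hγ
    have hγneg : ¬ b.IsPos γ := by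
      rw [RootPairing.Base.isPos_iff, hht]
      have := hθ.height_le β
      lia
    rw [hθ.kernel_root hβ hγ, heightSolution_of_isPos x y hβpos,
      heightSolution_of_not_isPos x y hγneg, mul_sub, smul_sub, hy, smul_smul, mul_smul_comm,
      smul_smul, ← zpow_add₀ τ_ne_zero, ← zpow_one_add₀ τ_ne_zero, hht]
    congr 3
    ring
  · have h := hθ.kernel_zero
    have hθpos := hθ.isPos
    have e1 : τ ^ (-b.height θ) • x = τ • (PowerSeries.X * y) := by
      rw [hy, smul_smul, ← zpow_add₀ τ_ne_zero, neg_add_cancel_left, zpow_one]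
    have e2 : τ • (PowerSeries.X * (PowerSeries.X * (τ ^ b.height θ • y))) =
        PowerSeries.X * x := by
      rw [hy, mul_smul_comm, mul_smul_comm, mul_smul_comm, smul_smul, zpow_add_one₀ τ_ne_zero,
        mul_comm τ]
    rw [hneg, heightSolution_of_isPos x y hθpos,
      heightSolution_of_not_isPos x y (not_isPos_reflectionPerm_self hθpos),
      height_reflectionPerm_self', neg_neg, mul_sub, mul_sub, smul_sub, e1, e2, ← h, hx, mul_add,
      mul_smul_comm, mul_smul_comm]
    abel

theorem IsHighestRoot.kernel_neg_root [R.IsReduced] {b : R.Base} {θ : ι}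
    (hθ : IsHighestRoot b θ) {α : ι} (hα : b.IsPos α) :
    (PowerSeries.C (τ ^ b.height θ) * PowerSeries.X - 1) * kernel b (-R.root α) =
      PowerSeries.C (τ ^ b.height α * (τ⁻¹ - 1)) * kernel b 0 := by
  set u : PowerSeries Qt := PowerSeries.C (τ ^ b.height θ) * PowerSeries.X - 1 with hu
  have hu0 : PowerSeries.constantCoeff u ≠ 0 := by simp [hu]
  -- This y results from eliminating x between the two conditions; u is invertible since its
  -- constant term is -1.
  set y : PowerSeries Qt := u⁻¹ * (PowerSeries.C (τ⁻¹ - 1) * kernel b 0) with hy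
  have huy : u * y = PowerSeries.C (τ⁻¹ - 1) * kernel b 0 := by
    rw [hy, ← mul_assoc, PowerSeries.mul_inv_cancel _ hu0, one_mul]
  have hx : τ ^ (b.height θ + 1) • (PowerSeries.X * y) = τ • y + (1 - τ) • kernel b 0 := by
    have h1 : (1 - τ) • kernel b 0 = τ • (u * y) := by
      rw [huy, ← PowerSeries.smul_eq_C_mul, smul_smul, mul_sub, mul_inv_cancel₀ τ_ne_zero, mul_one]
    rw [h1, hu, sub_mul, mul_assoc, ← PowerSeries.smul_eq_C_mul, one_mul, smul_sub, smul_smul,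
      zpow_add_one₀ τ_ne_zero, mul_comm τ]
    abel
  have h := hθ.kernel_root_eq hx rfl (R.reflectionPerm α α)
  rw [heightSolution_of_not_isPos _ _ (not_isPos_reflectionPerm_self hα),
    height_reflectionPerm_self', neg_neg, R.root_reflectionPerm, R.reflection_apply_self] at h
  rw [h, mul_smul_comm, huy, PowerSeries.smul_eq_C_mul, ← mul_assoc, ← map_mul]

end Solution

/-! ### Passage to ℚ(t)((q^{1/m})) -/

section Transport

/-- The embedding of series in `q` into `ℚ(t)((q^{1/m}))`. -/
def seriesEmbed (m : ℕ) (hm : m ≠ 0) : PowerSeries Qt →+* SeriesField :=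
  (HahnSeries.ofPowerSeries ℤ Qt).comp (PowerSeries.expand m hm : PowerSeries Qt →ₐ[Qt] _)

theorem embed_C (a : Qt) : embed (RatFunc.C a) = HahnSeries.ofPowerSeries ℤ Qt (PowerSeries.C a) := by
  rw [← RatFunc.algebraMap_C, embed, IsFractionRing.lift_algebraMap]
  simp

theorem embed_X : embed RatFunc.X = HahnSeries.ofPowerSeries ℤ Qt PowerSeries.X := by
  rw [← RatFunc.algebraMap_X, embed, IsFractionRing.lift_algebraMap]
  simp

theorem seriesEmbed_C (m : ℕ) (hm : m ≠ 0) (a : Qt) :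
    seriesEmbed m hm (PowerSeries.C a) = embed (RatFunc.C a) := by
  rw [embed_C]
  change HahnSeries.ofPowerSeries ℤ Qt (PowerSeries.expand m hm (PowerSeries.C a)) = _
  rw [PowerSeries.expand_C]

theorem seriesEmbed_X (m : ℕ) (hm : m ≠ 0) :
    seriesEmbed m hm PowerSeries.X = embed (q m) := by
  rw [q, map_pow, embed_X]
  simp [seriesEmbed]

variable {ι E E' : Type*} [AddCommGroup E] [Module ℚ E] [AddCommGroup E'] [Module ℚ E']
variable {R : RootPairing ι ℚ E E'}

theorem scalarProduct_e_one (m : ℕ) (hm : m ≠ 0) (b : R.Base) (μ : weightLattice R) :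
    scalarProduct m hm b (e μ) 1 = seriesEmbed m hm (kernel b (-(μ : E))) := by
  rw [scalarProduct, map_one, mul_one, constantTerm, e]
  simp [seriesEmbed]

theorem scalarProduct_one_one (m : ℕ) (hm : m ≠ 0) (b : R.Base) :
    scalarProduct m hm b 1 1 = seriesEmbed m hm (kernel b 0) := by
  have h := scalarProduct_e_one m hm b 0
  simpa [e, ← AddMonoidAlgebra.one_def] using h

end Transport

end CherednikProduct

end

theorem mainTheorem3 {ι E E' : Type*} [Finite ι]
    [AddCommGroup E] [Module ℚ E] [AddCommGroup E'] [Module ℚ E']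
    (R : RootPairing ι ℚ E E') [R.IsRootSystem] [R.IsCrystallographic] [R.IsReduced]
    [R.IsIrreducible] (b : R.Base)
    (m : ℕ) (hm : m ≠ 0) (_hmP : ∀ μ ∈ CherednikProduct.weightLattice R, m • μ ∈ R.rootSpan ℤ) :
    (∃ θ : ι, CherednikProduct.IsHighestRoot b θ ∧
      (CherednikProduct.exponent b (CherednikProduct.rank b) : ℤ) = b.height θ) ∧
    ∀ α : ι, b.IsPos α →
      CherednikProduct.scalarProduct m hm b
          (CherednikProduct.e (CherednikProduct.rootWeight R α)) 1 =
        CherednikProduct.embed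
          (CherednikProduct.t ^ (-2 * b.height α) *
            ((CherednikProduct.t ^ 2 - 1) /
              (CherednikProduct.q m *
                CherednikProduct.t ^
                  (-2 * (CherednikProduct.exponent b (CherednikProduct.rank b) : ℤ)) - 1))) *
        CherednikProduct.scalarProduct m hm b 1 1 := by
  open CherednikProduct in
  obtain ⟨θ, hθ⟩ := exists_isHighestRoot b
  refine ⟨⟨θ, hθ, hθ.exponent_rank⟩, fun α hα => ?_⟩
  have ht : ∀ n : ℤ, RatFunc.C (τ ^ n) = t ^ (-2 * n) := by
    intro n
    rw [τ, ← zpow_mul, map_zpow₀]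
    rfl
  have ht' : RatFunc.C (τ⁻¹ - 1) = t ^ 2 - 1 := by
    rw [map_sub, map_one, ← zpow_neg_one, ht]
    rfl
  have h := congrArg (seriesEmbed m hm) (hθ.kernel_neg_root hα)
  rw [map_mul, map_mul, map_sub, map_mul, map_one, seriesEmbed_C, seriesEmbed_X, seriesEmbed_C, ht,
    map_mul, ht, ht'] at h
  rw [scalarProduct_e_one, scalarProduct_one_one, hθ.exponent_rank]
  -- The denominator is the image of a power series with constant term -1, which is a unit.
  have hne : q m * t ^ (-2 * b.height θ) - 1 ≠ 0 := by
    intro h0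
    have h1 : IsUnit (PowerSeries.C (τ ^ b.height θ) * PowerSeries.X - 1 : PowerSeries Qt) := by
      rw [PowerSeries.isUnit_iff_constantCoeff]
      simp
    refine (h1.map (seriesEmbed m hm)).ne_zero ?_
    rw [map_sub, map_mul, map_one, seriesEmbed_C, seriesEmbed_X, ht, ← map_mul,
      mul_comm, ← map_one embed, ← map_sub, h0, map_zero]
  rw [← mul_div_assoc, map_div₀, div_mul_eq_mul_div, eq_div_iff ((map_ne_zero _).mpr hne), ← h,
    map_sub, map_mul, map_one]
  change seriesEmbed m hm (kernel b (-R.root α)) * _ = _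
  ring
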